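/- Logarithms are to base $2$. A Boolean circuit is built from two-input gates, each computing an arbitrary function $\{0,1\}^2\to\{0,1\}$; its size is its number of gates (input variables are free). Let $\psi(n,g)$ be the number of Boolean functions of $n$ variables computable by circuits with at most $g$ gates. For $\lambda:\mathbb{N}\to\mathbb{N}$ (value $0$ allowed), $SIZE(\lambda)$ is the class of all sequences $(f_n)$, where $f_n$ is a Boolean function of $n$ variables, for which there is a constant $c$ such that $f_n$ has a circuit of size at most $c\lambda(n)$ for all sufficiently large $n$. We say that $\gamma$ outstrips $\lambda$ if for every $c>0$ we have $\gamma(n)>c\lambda(n)$ for all sufficiently large $n$. Theorem. Let $\gamma,\lambda:\mathbb{N}\to\mathbb{N}$ be functions such that $\lambda(n)=\Omega(n\log n)$, $\gamma$ outstrips $\lambda$, and $\gamma(n)\le 2^{n-2}/n$ for all sufficiently large $n$. Then there is a sequence $(C_n)$, where each $C_n$ is a set of Boolean functions of $n$ variables, such that: 1. (largeness) $|C_n|\ge 2^{2^n}/\psi(n,\gamma(n))$ for all sufficiently large $n$; 2. (non-uniform linear constructivity) there is a constant $c$ such that for every $n$ some circuit of size at most $c\,2^n$, given the $2^n$-bit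 truth table of a Boolean function $f$ of $n$ variables as input, decides whether $f\in C_n$; 3. (usefulness against $SIZE(\lambda)$) every sequence $(f_n)$ of Boolean functions, $f_n$ of $n$ variables, with $f_n\in C_n$ for infinitely many $n$ satisfies $(f_n)\notin SIZE(\lambda)$; 4. every $C_n$ is a Hamming ball, that is, the set of all Boolean functions of $n$ variables that differ from some fixed function $h_n$ at no more than $r_n$ points of $\{0,1\}^n$, and for all sufficiently large $n$ no function in $C_n$ is computable by a circuit with at most $\gamma(n)/2$ gates. -/

import Mathlib

open Filter

namespace AlmostNatural

/-- Boolean functions of `n` variables. -/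
abbrev BoolFn (n : ℕ) : Type := (Fin n → Bool) → Bool

/-- Boolean circuits with `n` inputs and `g` gates, as straight-line programs: gates are added one
at a time, each gate has exactly two inputs, computes an arbitrary binary Boolean operation, and
reads any two (not necessarily distinct) of the `n + g` wires that exist so far, namely the
`n` input variables followed by the outputs of the `g` earlier gates. The fan-out is unbounded. -/
inductive Circuit (n : ℕ) : ℕ → Type
  | inputs : Circuit n 0
  | addGate {g : ℕ} (C : Circuit n g) (op : Bool → Bool → Bool) (l r : Fin (n + g)) :
      Circuit n (g + 1)

/-- The values carried by all the wires of a circuit on input `x`. -/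
def Circuit.eval {n : ℕ} : {g : ℕ} → Circuit n g → (Fin n → Bool) → (Fin (n + g) → Bool)
  | _, .inputs, x => x
  | _, .addGate (g := g) C op l r, x =>
      Fin.snoc (n := n + g) (α := fun _ => Bool) (C.eval x) (op (C.eval x l) (C.eval x r))

/-- The circuit `C` computes `f`: one of its wires, the output, always carries the value of `f`. -/
def Circuit.Computes {n g : ℕ} (C : Circuit n g) (f : BoolFn n) : Prop :=
  ∃ o : Fin (n + g), ∀ x, C.eval x o = f x

/-- `f` is computable by a Boolean circuit with at most `s` gates, that is, the minimum circuit
size of `f` is at most `s`. -/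
def ComputableWithGates {n : ℕ} (f : BoolFn n) (s : ℝ) : Prop :=
  ∃ (g : ℕ) (C : Circuit n g), (g : ℝ) ≤ s ∧ C.Computes f

/-- The number of Boolean functions of `n` variables that can be computed by Boolean circuits with
at most `g` gates. -/
noncomputable def psi (n g : ℕ) : ℕ :=
  Set.ncard {f : BoolFn n | ComputableWithGates f g}

/-- The class of all sequences `(f_n)` of Boolean functions (`f_n` of `n` variables) whose minimum
circuit size is at most a constant times `lam n` for all sufficiently large `n`. -/
def SIZE (lam : ℕ → ℕ) : Set ((n : ℕ) → BoolFn n) :=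
  {f | ∃ c : ℝ, ∀ᶠ n in atTop, ComputableWithGates (f n) (c * lam n)}

/-- `gam` outstrips `lam`. -/
def Outstrips (gam lam : ℕ → ℕ) : Prop :=
  ∀ c : ℝ, 0 < c → ∃ n₀ : ℕ, ∀ n ≥ n₀, c * lam n < gam n

/-- A Boolean function property: a set of Boolean functions on `n` variables for each `n`. -/
abbrev BoolProperty : Type := (n : ℕ) → Set (BoolFn n)

/-- The truth table of `f`, a bit string of length `2 ^ n`: its entry at position `k` is the value
of `f` at the binary digits of `k`. -/
def truthTable {n : ℕ} (f : BoolFn n) : Fin (2 ^ n) → Bool :=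
  fun k => f fun i => finTwoEquiv (finFunctionFinEquiv.symm k i)

/-- Largeness with density `δ`. -/
def IsLarge (C : BoolProperty) (δ : ℕ → ℝ) : Prop :=
  ∀ᶠ n in atTop, (2 : ℝ) ^ (2 ^ n) * δ n ≤ (C n).ncard

/-- Non-uniform linear constructivity: membership of `f` in `C n`, given the truth table of `f` as
input, is decided by circuits whose size is linear in the length `2 ^ n` of the truth table. -/
def NonuniformlyLinearConstructive (C : BoolProperty) : Prop :=
  ∃ c : ℝ, ∀ n : ℕ, ∃ D : BoolFn (2 ^ n),
    ComputableWithGates D (c * 2 ^ n) ∧ ∀ f : BoolFn n, D (truthTable f) = true ↔ f ∈ C n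

/-- Non-uniformly linear-natural properties with density `δ`. -/
def NonuniformlyLinearNatural (C : BoolProperty) (δ : ℕ → ℝ) : Prop :=
  IsLarge C δ ∧ NonuniformlyLinearConstructive C

/-- `C` is useful against the class `Λ`: no sequence of functions that is infinitely often in `C`
belongs to `Λ`. -/
def UsefulAgainst (C : BoolProperty) (Λ : Set ((n : ℕ) → BoolFn n)) : Prop :=
  ∀ f : (n : ℕ) → BoolFn n, (∃ᶠ n in atTop, f n ∈ C n) → f ∉ Λ

/-- The Hamming ball of radius `r` around `h`: all Boolean functions that differ from `h` in at
most `r` truth table entries. -/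
def hammingBall {n : ℕ} (h : BoolFn n) (r : ℕ) : Set (BoolFn n) :=
  {f | hammingDist f h ≤ r}

end AlmostNatural

/-! Call a function easy if γ/2 gates suffice for it. Let `r` be a radius at which some ball
contains no easy function while every ball of radius `r + 1` contains one. The balls of radius `r +
1` around the easy functions then cover all functions. One more unit of radius multiplies the volume
by at most `2 ^ n + 1`, so the ball of radius `r` has at least 2^(2^n) / (ψ(n, γ/2) (2^n + 1))
elements (`exists_large_hammingBall_disjoint`). Membership in a ball is a threshold on a count of `2
^ n` mismatch bits, hence has linear-size circuits (`exists_circuit_hammingBall`). Usefulness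
follows because cλ is eventually below γ/2.

The factor `2 ^ n + 1` is absorbed by the growth of ψ between γ/2 and γ (`psi_growth`). Xoring with
the indicator of a subcube of codimension `k` costs `k + 2` gates and flips one of `2 ^ k`
independent coordinates. By edge isoperimetry (`sum_card_inner_edges_le`), a family whose squared
size is at most 2^(2^k) grows by a factor 3/2 under some such flip. With `k` at most about 2 log γ,
the `2 * (n + 1)` rounds needed cost O(n log γ) gates, which γ ≥ 96 n log n pays for. -/

namespace AlmostNatural

/-! ### Composing circuits and counting their gates -/

/-- Some circuit with `g` gates computes all functions of `S` simultaneously. -/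
def Joint {n : ℕ} (S : Set (BoolFn n)) (g : ℕ) : Prop :=
  ∃ C : Circuit n g, ∀ f ∈ S, C.Computes f

/-- Every circuit that computes all of `S` can be extended by `k` gates so as to compute all of
`T` as well. -/
def Extends {n : ℕ} (S : Set (BoolFn n)) (k : ℕ) (T : Set (BoolFn n)) : Prop :=
  ∀ (U : Set (BoolFn n)) (g : ℕ), S ⊆ U → Joint U g → Joint (U ∪ T) (g + k)

/-- The set of input variables. -/
def inputVars (n : ℕ) : Set (BoolFn n) := Set.range fun i x => x i

theorem joint_inputVars (n : ℕ) : Joint (inputVars n) 0 := by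
  refine ⟨.inputs, ?_⟩
  rintro _ ⟨i, rfl⟩
  exact ⟨i, fun x => rfl⟩

theorem Joint.mono {n g : ℕ} {S T : Set (BoolFn n)} (h : Joint T g) (hST : S ⊆ T) :
    Joint S g := by
  obtain ⟨C, hC⟩ := h
  exact ⟨C, fun f hf => hC f (hST hf)⟩

theorem Circuit.Computes.addGate {n g : ℕ} {C : Circuit n g} {f : BoolFn n}
    (h : C.Computes f) (op : Bool → Bool → Bool) (l r : Fin (n + g)) :
    (C.addGate op l r).Computes f := by
  obtain ⟨o, ho⟩ := h
  refine ⟨o.castSucc, fun x => ?_⟩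
  rw [← ho x]
  exact Fin.snoc_castSucc (α := fun _ => Bool) _ _ o

theorem Circuit.computes_addGate {n g : ℕ} (C : Circuit n g) (op : Bool → Bool → Bool)
    (l r : Fin (n + g)) : (C.addGate op l r).Computes
      (fun x => op (C.eval x l) (C.eval x r)) :=
  ⟨Fin.last (n + g), fun _ => Fin.snoc_last (α := fun _ => Bool) _ _⟩

theorem extends_gate {n : ℕ} {S : Set (BoolFn n)} {a b : BoolFn n} (ha : a ∈ S) (hb : b ∈ S)
    (op : Bool → Bool → Bool) : Extends S 1 {fun x => op (a x) (b x)} := by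
  rintro U g hU ⟨C, hC⟩
  obtain ⟨l, hl⟩ := hC a (hU ha)
  obtain ⟨r, hr⟩ := hC b (hU hb)
  refine ⟨C.addGate op l r, ?_⟩
  rintro f (hf | rfl)
  · exact (hC f hf).addGate op l r
  · obtain ⟨o, ho⟩ := C.computes_addGate op l r
    exact ⟨o, fun x => by rw [ho x]; simp only [hl x, hr x]⟩

theorem extends_gate' {n : ℕ} {S : Set (BoolFn n)} {a b f : BoolFn n} (ha : a ∈ S) (hb : b ∈ S)
    (op : Bool → Bool → Bool) (h : ∀ x, f x = op (a x) (b x)) : Extends S 1 {f} := by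
  obtain rfl : f = fun x => op (a x) (b x) := funext h
  exact extends_gate ha hb op

/-- Gate counts add because `Extends` ranges over all supersets of `S`: the second extension is
applied to `U ∪ T`, so earlier wires are reused rather than recomputed. -/
theorem Extends.trans {n k l : ℕ} {S T V : Set (BoolFn n)} (h₁ : Extends S k T)
    (h₂ : Extends (S ∪ T) l V) : Extends S (k + l) (T ∪ V) := by
  intro U g hU hJ
  have := h₂ (U ∪ T) (g + k) (Set.union_subset_union_left _ hU) (h₁ U g hU hJ)
  rwa [Set.union_assoc, add_assoc] at this

theorem Extends.mono {n k : ℕ} {S S' T T' : Set (BoolFn n)} (h : Extends S k T) (hS : S ⊆ S')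
    (hT : T' ⊆ T) : Extends S' k T' := fun U g hU hJ =>
  (h U g (hS.trans hU) hJ).mono (Set.union_subset_union_right _ hT)

/-- Pad a circuit with dummy gates. -/
theorem Joint.pad {n g g' : ℕ} {S : Set (BoolFn n)} (hn : 0 < n) (h : Joint S g) (hg : g ≤ g') :
    Joint S g' := by
  induction g', hg using Nat.le_induction with
  | base => exact h
  | succ m _ ih =>
    obtain ⟨C, hC⟩ := ih
    -- Even a constant gate must read two wires; `0 < n` supplies one.
    exact ⟨C.addGate (fun _ _ => true) ⟨0, by omega⟩ ⟨0, by omega⟩,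
      fun f hf => (hC f hf).addGate _ _ _⟩

theorem Circuit.computes_input {n g : ℕ} (C : Circuit n g) (i : Fin n) :
    C.Computes (fun x => x i) := by
  induction C with
  | inputs => exact ⟨i, fun x => rfl⟩
  | addGate C op l r ih => exact ih.addGate op l r

theorem Joint.union_inputVars {n g : ℕ} {S : Set (BoolFn n)} (h : Joint S g) :
    Joint (S ∪ inputVars n) g := by
  obtain ⟨C, hC⟩ := h
  refine ⟨C, ?_⟩
  rintro f (hf | ⟨i, rfl⟩)
  · exact hC f hf
  · exact C.computes_input i

theorem Joint.computable {n g : ℕ} {S : Set (BoolFn n)} (h : Joint S g) {f : BoolFn n}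
    (hf : f ∈ S) {s : ℝ} (hs : (g : ℝ) ≤ s) : ComputableWithGates f s := by
  obtain ⟨C, hC⟩ := h
  exact ⟨g, C, hs, hC f hf⟩

theorem ComputableWithGates.mono {n : ℕ} {f : BoolFn n} {s t : ℝ} (h : ComputableWithGates f s)
    (hst : s ≤ t) : ComputableWithGates f t := by
  obtain ⟨g, C, hg, hC⟩ := h
  exact ⟨g, C, hg.trans hst, hC⟩

theorem ComputableWithGates.joint {n g : ℕ} (hn : 0 < n) {f : BoolFn n}
    (h : ComputableWithGates f g) : Joint {f} g := by
  obtain ⟨g', C, hg', hC⟩ := h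
  exact Joint.pad hn ⟨C, by rintro _ rfl; exact hC⟩ (by exact_mod_cast hg')

/-! ### Arithmetic on binary numbers -/

/-- The `m` low-order bits of a number that depends on the input. -/
def bits {n : ℕ} (a : (Fin n → Bool) → ℕ) (m : ℕ) : Set (BoolFn n) :=
  {f | ∃ i < m, f = fun x => (a x).testBit i}

/-- The carry into position `i` when adding `a` and `b`. -/
def carryBit (a b i : ℕ) : Bool := decide (2 ^ i ≤ a % 2 ^ i + b % 2 ^ i)

theorem mod_two_pow_succ_eq (a i : ℕ) :
    a % 2 ^ (i + 1) = a % 2 ^ i + 2 ^ i * (a.testBit i).toNat := by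
  rw [Nat.mod_pow_succ, Nat.toNat_testBit]

theorem carryBit_succ (a b i : ℕ) : carryBit a b (i + 1) =
    ((a.testBit i && b.testBit i) || (carryBit a b i && (a.testBit i ^^ b.testBit i))) := by
  have ha := Nat.mod_lt a (Nat.two_pow_pos i)
  have hb := Nat.mod_lt b (Nat.two_pow_pos i)
  unfold carryBit
  rw [mod_two_pow_succ_eq, mod_two_pow_succ_eq, pow_succ]
  generalize 2 ^ i = p at *
  cases a.testBit i <;> cases b.testBit i <;> simp <;> omega

theorem testBit_add_eq (a b i : ℕ) : (a + b).testBit i =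
    ((a.testBit i ^^ b.testBit i) ^^ carryBit a b i) := by
  have ha := Nat.mod_lt a (Nat.two_pow_pos i)
  have hb := Nat.mod_lt b (Nat.two_pow_pos i)
  -- Bit `i` is the parity of the quotient by `2 ^ i`, and the carry is the overflow of the
  -- remainders.
  have hdiv : (a + b) / 2 ^ i = a / 2 ^ i + b / 2 ^ i + (carryBit a b i).toNat := by
    have h := Nat.add_div (a := a) (b := b) (Nat.two_pow_pos i)
    rw [h]
    unfold carryBit
    split <;> simp_all
  have h1 : ∀ c : ℕ, c.testBit i = decide (c / 2 ^ i % 2 = 1) := fun c => by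
    rw [Nat.testBit_eq_decide_div_mod_eq]
  rw [h1, h1, h1, hdiv]
  generalize a / 2 ^ i = p
  generalize b / 2 ^ i = q
  rcases Nat.mod_two_eq_zero_or_one p with hp | hp <;>
  rcases Nat.mod_two_eq_zero_or_one q with hq | hq <;>
  cases carryBit a b i <;> simp [Nat.add_mod, hp, hq]

/-- A ripple-carry adder. -/
theorem extends_add_aux {n m : ℕ} (a b : (Fin n → Bool) → ℕ) (hn : 0 < n) (k : ℕ) (hk : k ≤ m) :
    Extends (inputVars n ∪ (bits a m ∪ bits b m)) (5 * k + 1)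
      ({fun x => carryBit (a x) (b x) k} ∪ bits (fun x => a x + b x) k) := by
  induction k with
  | zero =>
    -- The initial carry is constantly false; this gate is the `+ 1` in the count.
    have h := extends_gate' (S := inputVars n ∪ (bits a m ∪ bits b m))
      (a := fun x => x ⟨0, hn⟩) (b := fun x => x ⟨0, hn⟩)
      (f := fun x => carryBit (a x) (b x) 0)
      (Or.inl ⟨_, rfl⟩) (Or.inl ⟨_, rfl⟩) (fun _ _ => false)
      (by intro x; simp [carryBit, Nat.mod_one])
    refine h.mono subset_rfl ?_
    rintro f (hf | ⟨i, hi, -⟩)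
    · exact hf
    · omega
  | succ k ih =>
    have hka : (fun x => (a x).testBit k) ∈ bits a m := ⟨k, by omega, rfl⟩
    have hkb : (fun x => (b x).testBit k) ∈ bits b m := ⟨k, by omega, rfl⟩
    set S := inputVars n ∪ (bits a m ∪ bits b m) with hS
    have h0 := ih (by omega)
    have haS : (fun x => (a x).testBit k) ∈ S := Or.inr (Or.inl hka)
    have hbS : (fun x => (b x).testBit k) ∈ S := Or.inr (Or.inr hkb)
    -- A full adder in five gates: the xor of the two bits serves both the sum and the next carry.
    have h1 := h0.trans (extends_gate' (f := fun x => (a x).testBit k ^^ (b x).testBit k)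
      (Or.inl haS) (Or.inl hbS) xor fun _ => rfl)
    have h2 := h1.trans (extends_gate' (f := fun x => (a x).testBit k && (b x).testBit k)
      (Or.inl haS) (Or.inl hbS) and fun _ => rfl)
    have h3 := h2.trans (extends_gate' (f := fun x => (a x + b x).testBit k)
      (a := fun x => (a x).testBit k ^^ (b x).testBit k)
      (b := fun x => carryBit (a x) (b x) k)
      (by simp) (by simp) xor fun _ => testBit_add_eq _ _ _)
    have h4 := h3.trans (extends_gate'
      (f := fun x => carryBit (a x) (b x) k && ((a x).testBit k ^^ (b x).testBit k))
      (a := fun x => carryBit (a x) (b x) k)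
      (b := fun x => (a x).testBit k ^^ (b x).testBit k)
      (by simp) (by simp) and fun _ => rfl)
    have h5 := h4.trans (extends_gate'
      (f := fun x => carryBit (a x) (b x) (k + 1))
      (a := fun x => (a x).testBit k && (b x).testBit k)
      (b := fun x => carryBit (a x) (b x) k && ((a x).testBit k ^^ (b x).testBit k))
      (by simp) (by simp) or fun _ => carryBit_succ _ _ _)
    have h6 : 5 * (k + 1) + 1 = 5 * k + 1 + 1 + 1 + 1 + 1 + 1 := by ring
    rw [h6]
    refine h5.mono subset_rfl ?_
    rintro f (rfl | ⟨i, hi, rfl⟩)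
    · simp
    · rcases Nat.lt_succ_iff_lt_or_eq.mp hi with hi | rfl
      · exact Or.inl <| Or.inl <| Or.inl <| Or.inl <| Or.inl <| Or.inr ⟨i, hi, rfl⟩
      · simp

theorem extends_add {n m : ℕ} (a b : (Fin n → Bool) → ℕ) (hn : 0 < n)
    (ha : ∀ x, a x < 2 ^ m) (hb : ∀ x, b x < 2 ^ m) :
    Extends (inputVars n ∪ (bits a m ∪ bits b m)) (5 * m + 1)
      (bits (fun x => a x + b x) (m + 1)) := by
  refine (extends_add_aux a b hn m le_rfl).mono subset_rfl ?_
  rintro f ⟨i, hi, rfl⟩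
  rcases Nat.lt_succ_iff_lt_or_eq.mp hi with hi | rfl
  · exact Or.inr ⟨i, hi, rfl⟩
  -- Both summands have bit `m` equal to zero, so the top bit of the sum is the final carry.
  · left
    funext x
    rw [testBit_add_eq, Nat.testBit_lt_two_pow (ha x), Nat.testBit_lt_two_pow (hb x)]
    simp

/-- The number of `j < 2 ^ m` such that `p (s + j)` holds. -/
def blockCount {n : ℕ} (p : ℕ → BoolFn n) (s m : ℕ) (x : Fin n → Bool) : ℕ :=
  ∑ j ∈ Finset.range (2 ^ m), (p (s + j) x).toNat

theorem blockCount_succ {n : ℕ} (p : ℕ → BoolFn n) (s m : ℕ) (x : Fin n → Bool) :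
    blockCount p s (m + 1) x = blockCount p s m x + blockCount p (s + 2 ^ m) m x := by
  unfold blockCount
  rw [pow_succ, mul_two, Finset.sum_range_add]
  simp only [add_assoc]

theorem blockCount_lt {n : ℕ} (p : ℕ → BoolFn n) (s m : ℕ) (x : Fin n → Bool) :
    blockCount p s m x < 2 ^ (m + 1) := by
  have : blockCount p s m x ≤ ∑ j ∈ Finset.range (2 ^ m), 1 :=
    Finset.sum_le_sum fun j _ => Bool.toNat_le _
  have h2 := Nat.two_pow_pos m
  simp at this
  rw [pow_succ]
  omega

/-- Linear-size circuits for counting. -/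
theorem extends_blockCount {n : ℕ} (hn : 0 < n) (p : ℕ → BoolFn n) (m : ℕ) :
    ∀ s, (∀ j < 2 ^ m, Extends (inputVars n) 1 {p (s + j)}) →
      ∃ k, k + 5 * m + 11 ≤ 12 * 2 ^ m ∧
        Extends (inputVars n) k (bits (blockCount p s m) (m + 1)) := by
  induction m with
  | zero =>
    intro s h
    refine ⟨1, by norm_num, (h 0 (by norm_num)).mono subset_rfl ?_⟩
    rintro f ⟨i, hi, rfl⟩
    obtain rfl : i = 0 := by omega
    funext x
    simp only [blockCount]
    cases h : p s x <;> simp [h]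
  | succ m ih =>
    intro s h
    have hp : 2 ^ (m + 1) = 2 ^ m + 2 ^ m := by ring
    obtain ⟨k₁, hk₁, h₁⟩ := ih s fun j hj => h j (by omega)
    obtain ⟨k₂, hk₂, h₂⟩ := ih (s + 2 ^ m) fun j hj => by
      rw [add_assoc]; exact h _ (by omega)
    have h3 := (h₁.trans (h₂.mono Set.subset_union_left subset_rfl)).trans
      ((extends_add _ _ hn (blockCount_lt p s m) (blockCount_lt p (s + 2 ^ m) m)).mono
        subset_rfl subset_rfl)
    refine ⟨_, ?_, h3.mono subset_rfl ?_⟩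
    -- The slack `5 * m + 11` closes the recursion exactly: the adder costs `5 * m + 6`, and the new
    -- slack `5 * m + 16` brings the sum to twice the old slack.
    · omega
    · refine subset_trans (le_of_eq ?_) Set.subset_union_right
      congr 1
      funext x
      exact blockCount_succ p s m x

/-- Comparison with a constant. -/
theorem extends_le_const {n : ℕ} (hn : 0 < n) (a : (Fin n → Bool) → ℕ) (r m : ℕ) :
    Extends (inputVars n ∪ bits a m) (m + 1) {fun x => decide (a x % 2 ^ m ≤ r % 2 ^ m)} := by
  suffices H : ∀ k ≤ m, Extends (inputVars n ∪ bits a m) (1 + k)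
      {fun x => decide (a x % 2 ^ k ≤ r % 2 ^ k)} by
    rw [add_comm]; exact H m le_rfl
  intro k hk
  induction k with
  | zero =>
    exact extends_gate' (a := fun x => x ⟨0, hn⟩) (b := fun x => x ⟨0, hn⟩)
      (Or.inl ⟨_, rfl⟩) (Or.inl ⟨_, rfl⟩) (fun _ _ => true) (by intro x; simp [Nat.mod_one])
  | succ k ih =>
    have h := (ih (by omega)).trans (extends_gate'
      (f := fun x => decide (a x % 2 ^ (k + 1) ≤ r % 2 ^ (k + 1)))
      (a := fun x => decide (a x % 2 ^ k ≤ r % 2 ^ k)) (b := fun x => (a x).testBit k)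
      (by simp) (Or.inl (Or.inr ⟨k, by omega, rfl⟩))
      -- The highest differing bit decides; on equality the verdict `u` on the lower bits stands.
      (fun u v => bif v == r.testBit k then u else r.testBit k) ?_)
    · exact h.mono subset_rfl Set.subset_union_right
    · intro x
      have ha := Nat.mod_lt (a x) (Nat.two_pow_pos k)
      have hb := Nat.mod_lt r (Nat.two_pow_pos k)
      rw [mod_two_pow_succ_eq, mod_two_pow_succ_eq]
      generalize 2 ^ k = p at *
      cases (a x).testBit k <;> cases r.testBit k <;> simp <;> omega

/-! ### Deciding membership in a Hamming ball -/

theorem hammingDist_eq_sum_truthTable {n : ℕ} (f h : BoolFn n) :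
    hammingDist f h = ∑ k : Fin (2 ^ n), (truthTable f k ^^ truthTable h k).toNat := by
  let e : Fin (2 ^ n) ≃ (Fin n → Bool) :=
    finFunctionFinEquiv.symm.trans (Equiv.arrowCongr (Equiv.refl _) finTwoEquiv)
  have h1 : ∀ (f : BoolFn n) k, truthTable f k = f (e k) := fun f k => rfl
  simp only [h1]
  rw [e.sum_comp fun y => (f y ^^ h y).toNat]
  unfold hammingDist
  rw [Finset.card_filter]
  refine Finset.sum_congr rfl fun y _ => ?_
  cases f y <;> cases h y <;> simp

/-- Membership in a Hamming ball is decided by circuits of linear size. -/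
theorem exists_circuit_hammingBall {n : ℕ} (h : BoolFn n) (r : ℕ) :
    ∃ D : BoolFn (2 ^ n), ComputableWithGates D (12 * 2 ^ n) ∧
      ∀ f : BoolFn n, D (truthTable f) = true ↔ f ∈ hammingBall h r := by
  have hN := Nat.two_pow_pos n
  let p : ℕ → BoolFn (2 ^ n) := fun j x =>
    if hj : j < 2 ^ n then x ⟨j, hj⟩ ^^ truthTable h ⟨j, hj⟩ else false
  -- The table of `h` is hard-wired into the gate operations, so each mismatch bit costs one gate.
  have hp : ∀ j < 2 ^ n, Extends (inputVars (2 ^ n)) 1 {p (0 + j)} := fun j hj =>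
    extends_gate' (a := fun x => x ⟨j, hj⟩) (b := fun x => x ⟨j, hj⟩) ⟨_, rfl⟩ ⟨_, rfl⟩
      (fun u _ => u ^^ truthTable h ⟨j, hj⟩) (by intro x; simp [p, hj])
  obtain ⟨k, hk, hE⟩ := extends_blockCount hN p n 0 hp
  -- Capping the radius makes it fit into `n + 1` bits and leaves the ball unchanged.
  let R := min r (2 ^ n)
  have hR : R < 2 ^ (n + 1) := by
    have : R ≤ 2 ^ n := min_le_right _ _
    rw [pow_succ]; omega
  have hE' := hE.trans (extends_le_const hN (blockCount p 0 n) R (n + 1))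
  have hJ := hE' _ 0 subset_rfl (joint_inputVars _)
  refine ⟨_, hJ.computable (Or.inr (Or.inr rfl)) ?_, fun f => ?_⟩
  · have : (0 + (k + (n + 1 + 1))) ≤ 12 * 2 ^ n := by omega
    exact_mod_cast this
  · have hc : blockCount p 0 n (truthTable f) = hammingDist f h := by
      rw [hammingDist_eq_sum_truthTable, blockCount, Finset.sum_range]
      refine Finset.sum_congr rfl fun j _ => ?_
      simp [p]
    have hd : hammingDist f h ≤ 2 ^ n := by
      have := hammingDist_le_card_fintype (x := f) (y := h)
      simpa using this
    rw [Nat.mod_eq_of_lt (blockCount_lt _ _ _ _), Nat.mod_eq_of_lt hR, hc]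
    simp only [decide_eq_true_eq, hammingBall, Set.mem_ofPred_eq, R]
    omega

/-! ### Edge isoperimetry in the cube -/

/-- Since a + b ≥ 2a, log(a + b) ≥ log a + 1; since 2^u ≤ 1 + u on [0, 1], log(a + b) ≥ log b + a/b.
Weighting these by a and b gives the claim. The term 2a pays for the edges between two halves of a
set in the isoperimetric induction. -/
theorem mul_log_add_mul_log_add_min_le {a b : ℝ} (ha : 0 ≤ a) (hab : a ≤ b) :
    a * Real.logb 2 a + b * Real.logb 2 b + 2 * a ≤ (a + b) * Real.logb 2 (a + b) := by
  rcases ha.eq_or_lt with rfl | ha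
  · simp
  have hb : 0 < b := ha.trans_le hab
  have h1 : Real.logb 2 a + 1 ≤ Real.logb 2 (a + b) := by
    have : Real.logb 2 a + 1 = Real.logb 2 (a * 2) := by
      rw [Real.logb_mul ha.ne' two_ne_zero, Real.logb_self_eq_one one_lt_two]
    rw [this]
    exact Real.logb_le_logb_of_le one_lt_two (by positivity) (by linarith)
  have h2 : Real.logb 2 b + a / b ≤ Real.logb 2 (a + b) := by
    have hu1 : a / b ≤ 1 := (div_le_one hb).mpr hab
    have hu0 : 0 ≤ a / b := by positivity
    have hbern : (2 : ℝ) ^ (a / b) ≤ 1 + a / b := by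
      have := rpow_one_add_le_one_add_mul_self (s := 1) (by norm_num) hu0 hu1
      norm_num at this
      linarith
    have : Real.logb 2 b + a / b = Real.logb 2 (b * 2 ^ (a / b)) := by
      rw [Real.logb_mul hb.ne' (by positivity), Real.logb_rpow two_pos (by norm_num)]
    rw [this]
    refine Real.logb_le_logb_of_le one_lt_two (by positivity) ?_
    calc b * 2 ^ (a / b) ≤ b * (1 + a / b) := by gcongr
      _ = a + b := by field_simp; ring
  have h3 : b * (Real.logb 2 b + a / b) = b * Real.logb 2 b + a := by field_simp
  have h4 := mul_le_mul_of_nonneg_left h1 ha.le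
  have h5 := mul_le_mul_of_nonneg_left h2 hb.le
  linarith

/-- If the map `σ i` flips the `i`-th of a family of Boolean coordinates and keeps the others,
then a set `A` has at most `|A| log |A|` oriented inner edges `a → σ i a`. -/
theorem sum_card_inner_edges_le {α ι : Type*} [DecidableEq α] [DecidableEq ι]
    (c : ι → α → Bool) (σ : ι → α → α) (hσ : ∀ i, Function.Injective (σ i))
    (hsame : ∀ i a, c i (σ i a) = !c i a) (hdiff : ∀ i j a, i ≠ j → c j (σ i a) = c j a)
    (S : Finset ι) : ∀ A : Finset α,
      ((∑ i ∈ S, (A.filter fun a => σ i a ∈ A).card : ℕ) : ℝ) ≤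
        A.card * Real.logb 2 A.card := by
  induction S using Finset.induction_on with
  | empty =>
    intro A
    simp only [Finset.sum_empty, Nat.cast_zero]
    rcases A.card.eq_zero_or_pos with h | h
    · simp [h]
    · exact mul_nonneg (Nat.cast_nonneg _) (Real.logb_nonneg one_lt_two (by exact_mod_cast h))
  | insert j S hj ih =>
    intro A
    let B : Bool → Finset α := fun v => A.filter fun a => c j a = v
    have hcard : A.card = (B false).card + (B true).card := by
      rw [← Finset.card_filter_add_card_filter_not (s := A) (fun a => c j a = false)]
      simp [B]
    -- Flips in the other directions preserve coordinate `j`, so they stay within the two halves.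
    have hin : ∀ i ∈ S, (A.filter fun a => σ i a ∈ A).card =
        ((B false).filter fun a => σ i a ∈ B false).card +
        ((B true).filter fun a => σ i a ∈ B true).card := by
      intro i hi
      have hij : i ≠ j := fun h => hj (h ▸ hi)
      rw [← Finset.card_filter_add_card_filter_not
        (s := A.filter fun a => σ i a ∈ A) (fun a => c j a = false)]
      congr 2
      · ext a
        simp only [B, Finset.mem_filter, hdiff i j a hij]
        tauto
      · ext a
        simp only [B, Finset.mem_filter, hdiff i j a hij, Bool.not_eq_false]
        tauto
    -- Flips in direction `j` inject each half into the other, so in each orientation the smaller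
    -- half bounds the number of crossing edges.
    have hcross : ∀ v : Bool, ((B v).filter fun a => σ j a ∈ A).card ≤ (B (!v)).card := by
      intro v
      refine Finset.card_le_card_of_injOn (σ j) ?_ (hσ j).injOn
      intro a ha
      simp only [B, Finset.coe_filter, Finset.mem_filter, Set.mem_ofPred_eq] at ha ⊢
      exact ⟨ha.2, by rw [hsame, ha.1.2]⟩
    have hself : ∀ v : Bool, ((B v).filter fun a => σ j a ∈ A).card ≤ (B v).card :=
      fun v => Finset.card_filter_le _ _
    have hj' : (A.filter fun a => σ j a ∈ A).card =
        ((B false).filter fun a => σ j a ∈ A).card +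
        ((B true).filter fun a => σ j a ∈ A).card := by
      rw [← Finset.card_filter_add_card_filter_not
        (s := A.filter fun a => σ j a ∈ A) (fun a => c j a = false)]
      simp only [B, Finset.filter_filter, Bool.not_eq_false]
      congr 2 <;> ext a <;> simp only [Finset.mem_filter] <;> tauto
    have hF := ih (B false)
    have hT := ih (B true)
    have h1 := hcross true
    have h2 := hcross false
    have h3 := hself true
    have h4 := hself false
    simp only [Bool.not_true, Bool.not_false] at h1 h2
    rw [Finset.sum_insert hj, Finset.sum_congr rfl hin, Finset.sum_add_distrib, hj', hcard]
    push_cast at hF hT ⊢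
    rcases le_total (B false).card (B true).card with h | h
    · have key := mul_log_add_mul_log_add_min_le (a := (B false).card) (b := (B true).card)
        (Nat.cast_nonneg _) (by exact_mod_cast h)
      have h1' : ((((B true).filter fun a => σ j a ∈ A).card : ℕ) : ℝ) ≤ (B false).card := by
        exact_mod_cast h1
      have h4' : ((((B false).filter fun a => σ j a ∈ A).card : ℕ) : ℝ) ≤ (B false).card := by
        exact_mod_cast h4
      linarith
    · have key := mul_log_add_mul_log_add_min_le (a := (B true).card) (b := (B false).card)
        (Nat.cast_nonneg _) (by exact_mod_cast h)
      have h1' : ((((B true).filter fun a => σ j a ∈ A).card : ℕ) : ℝ) ≤ (B true).card := by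
        exact_mod_cast h3
      have h4' : ((((B false).filter fun a => σ j a ∈ A).card : ℕ) : ℝ) ≤ (B true).card := by
        exact_mod_cast h2
      rw [add_comm ((B true).card : ℝ)] at key
      linarith

/-- A set whose size is at most `2 ^ (|ι| / 2)` grows by a factor of `3 / 2` under some flip. -/
theorem exists_flip_growth {α ι : Type*} [DecidableEq α] [DecidableEq ι] [Fintype ι] [Nonempty ι]
    (c : ι → α → Bool) (σ : ι → α → α) (hσ : ∀ i, Function.Injective (σ i))
    (hsame : ∀ i a, c i (σ i a) = !c i a) (hdiff : ∀ i j a, i ≠ j → c j (σ i a) = c j a)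
    (A : Finset α) (hA : A.card ^ 2 ≤ 2 ^ Fintype.card ι) :
    ∃ i, 3 * A.card ≤ 2 * (A ∪ A.image (σ i)).card := by
  have hsum := sum_card_inner_edges_le c σ hσ hsame hdiff Finset.univ A
  -- Averaging: there are at most |A| log |A| ≤ |A| |ι| / 2 inner edges, so some direction has at
  -- most |A| / 2.
  have hex : ∃ i, 2 * (A.filter fun a => σ i a ∈ A).card ≤ A.card := by
    by_contra! hcon
    have h1 : ∑ i : ι, A.card < ∑ i : ι, 2 * (A.filter fun a => σ i a ∈ A).card :=
      Finset.sum_lt_sum_of_nonempty Finset.univ_nonempty fun i _ => hcon i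
    rw [← Finset.mul_sum, Finset.sum_const, Finset.card_univ, smul_eq_mul] at h1
    have hpos : 0 < A.card := by
      by_contra! h0
      obtain rfl : A = ∅ := Finset.card_eq_zero.mp (by omega)
      simp at h1
    have hlog : 2 * Real.logb 2 A.card ≤ Fintype.card ι := by
      have h2 : ((A.card : ℝ)) ^ 2 ≤ 2 ^ Fintype.card ι := by exact_mod_cast hA
      have h3 := Real.logb_le_logb_of_le one_lt_two (by positivity) h2
      rwa [Real.logb_pow, Real.logb_pow, Real.logb_self_eq_one one_lt_two, mul_one] at h3
    have h1' : ((Fintype.card ι : ℝ)) * A.card <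
        2 * ((∑ i : ι, (A.filter fun a => σ i a ∈ A).card : ℕ) : ℝ) := by exact_mod_cast h1
    have h5 := mul_le_mul_of_nonneg_left hlog (Nat.cast_nonneg (α := ℝ) A.card)
    linarith
  obtain ⟨i, hi⟩ := hex
  refine ⟨i, ?_⟩
  have h1 := Finset.card_union_add_card_inter A (A.image (σ i))
  have h2 : (A ∩ A.image (σ i)).card ≤ (A.filter fun a => σ i a ∈ A).card := by
    refine (Finset.card_le_card (t := (A.filter fun a => σ i a ∈ A).image (σ i)) ?_).trans
      Finset.card_image_le
    intro b hb
    simp only [Finset.mem_inter, Finset.mem_image, Finset.mem_filter] at hb ⊢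
    obtain ⟨hb, a, ha, rfl⟩ := hb
    exact ⟨a, ⟨ha, hb⟩, rfl⟩
  rw [Finset.card_image_of_injective _ (hσ i)] at h1
  omega

/-! ### Counting circuits -/

/-- The functions computable with at most `g` gates, as a finset. -/
noncomputable def sizeClass (n g : ℕ) : Finset (BoolFn n) :=
  (Set.toFinite {f : BoolFn n | ComputableWithGates f g}).toFinset

theorem mem_sizeClass {n g : ℕ} {f : BoolFn n} :
    f ∈ sizeClass n g ↔ ComputableWithGates f g := by
  simp [sizeClass]

theorem card_sizeClass (n g : ℕ) : (sizeClass n g).card = psi n g := by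
  rw [psi, sizeClass, Set.ncard_eq_toFinset_card _ (Set.toFinite _)]

theorem sizeClass_mono {n g g' : ℕ} (h : g ≤ g') : sizeClass n g ⊆ sizeClass n g' := fun f hf => by
  rw [mem_sizeClass] at hf ⊢
  exact hf.mono (by exact_mod_cast h)

theorem psi_pos {n : ℕ} (hn : 0 < n) (g : ℕ) : 0 < psi n g := by
  rw [← card_sizeClass, Finset.card_pos]
  refine ⟨fun x => x ⟨0, hn⟩, mem_sizeClass.mpr ?_⟩
  exact ⟨0, .inputs, by simp, ⟨0, hn⟩, fun x => rfl⟩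

/-- A circuit with at least one gate is given by its last gate and the circuit before it. -/
def circuitSuccEquiv (n g : ℕ) : Circuit n (g + 1) ≃
    Circuit n g × (Bool → Bool → Bool) × Fin (n + g) × Fin (n + g) where
  toFun | .addGate C op l r => (C, op, l, r)
  invFun p := .addGate p.1 p.2.1 p.2.2.1 p.2.2.2
  left_inv C := by cases C; rfl
  right_inv _ := rfl

/-- The only circuit without gates. -/
def circuitZeroEquiv (n : ℕ) : Circuit n 0 ≃ Unit where
  toFun _ := ()
  invFun _ := .inputs
  left_inv C := by cases C; rfl
  right_inv _ := rfl

theorem finite_and_card_circuit_le (n g M : ℕ) (hM : n + g ≤ M) :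
    Finite (Circuit n g) ∧ Nat.card (Circuit n g) ≤ (16 * M ^ 2) ^ g := by
  induction g with
  | zero =>
    exact ⟨Finite.of_equiv _ (circuitZeroEquiv n).symm, by
      simp [Nat.card_congr (circuitZeroEquiv n)]⟩
  | succ g ih =>
    obtain ⟨h1, h2⟩ := ih (by omega)
    refine ⟨Finite.of_equiv _ (circuitSuccEquiv n g).symm, ?_⟩
    rw [Nat.card_congr (circuitSuccEquiv n g), Nat.card_prod, Nat.card_prod, Nat.card_prod,
      Nat.card_fin, pow_succ]
    have h16 : Nat.card (Bool → Bool → Bool) = 16 := by simp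
    rw [h16]
    have h3 : n + g ≤ M := by omega
    calc _ ≤ (16 * M ^ 2) ^ g * (16 * (M * M)) := by gcongr
      _ = _ := by ring

/-- By padding, exactly `g` gates may be assumed; the circuit and its output wire then determine the
function. -/
theorem psi_le (n g M : ℕ) (hn : 0 < n) (hM : n + g ≤ M) :
    psi n g ≤ (16 * M ^ 2) ^ g * M := by
  obtain ⟨h1, h2⟩ := finite_and_card_circuit_le n g M hM
  let F : Circuit n g × Fin (n + g) → BoolFn n := fun p x => p.1.eval x p.2
  have hsub : {f : BoolFn n | ComputableWithGates f g} ⊆ Set.range F := by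
    intro f hf
    obtain ⟨C, hC⟩ := ComputableWithGates.joint hn hf
    obtain ⟨o, ho⟩ := hC f rfl
    exact ⟨(C, o), funext ho⟩
  calc psi n g ≤ (Set.range F).ncard := Set.ncard_le_ncard hsub (Set.toFinite _)
    _ ≤ Nat.card (Circuit n g × Fin (n + g)) := by
        rw [← Set.image_univ, ← Set.ncard_univ]
        exact Set.ncard_image_le
    _ = Nat.card (Circuit n g) * (n + g) := by rw [Nat.card_prod, Nat.card_fin]
    _ ≤ _ := by gcongr

/-! ### Growth of the number of computable functions -/

/-- The indicator of the subcube in which the first `k` variables are fixed to `y`. -/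
def subcube {n k : ℕ} (hk : k ≤ n) (y : Fin k → Bool) : BoolFn n :=
  fun x => decide (∀ i : Fin k, x (i.castLE hk) = y i)

/-- A conjunction of `k` literals: negations are absorbed into the gates, and the extra gate is the
empty conjunction. -/
theorem extends_subcube {n k : ℕ} (hn : 0 < n) (hk : k ≤ n) (y : Fin k → Bool) :
    Extends (inputVars n) (k + 1) {subcube hk y} := by
  suffices H : ∀ j (hj : j ≤ k), Extends (inputVars n) (1 + j)
      {subcube (hj.trans hk) fun i => y (i.castLE hj)} by
    rw [add_comm]; exact H k le_rfl
  intro j hj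
  induction j with
  | zero =>
    exact extends_gate' (a := fun x => x ⟨0, hn⟩) (b := fun x => x ⟨0, hn⟩)
      ⟨_, rfl⟩ ⟨_, rfl⟩ (fun _ _ => true) (by intro x; simp [subcube])
  | succ j ih =>
    have h := (ih (by omega)).trans (extends_gate'
      (f := subcube (hj.trans hk) fun i => y (i.castLE hj))
      (a := subcube (n := n) (k := j) (by omega) fun i => y (i.castLE (by omega)))
      (b := fun x => x ⟨j, by omega⟩)
      (Or.inr rfl) (Or.inl ⟨_, rfl⟩) (fun u v => u && (v == y ⟨j, by omega⟩)) ?_)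
    · exact h.mono subset_rfl Set.subset_union_right
    · intro x
      simp only [subcube, Fin.forall_fin_succ', Bool.decide_and, Bool.beq_eq_decide_eq]
      rfl

theorem computable_xor_subcube {n k g : ℕ} (hn : 0 < n) (hk : k ≤ n) (y : Fin k → Bool)
    {f : BoolFn n} (hf : ComputableWithGates f g) :
    ComputableWithGates (fun x => f x ^^ subcube hk y x) ((g + (k + 2) : ℕ) : ℝ) := by
  have h := ((extends_subcube hn hk y).mono (S' := {f} ∪ inputVars n) Set.subset_union_right
    subset_rfl).trans (extends_gate' (f := fun x => f x ^^ subcube hk y x)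
      (Or.inl (Or.inl rfl)) (Or.inr rfl) xor fun _ => rfl)
  exact (h _ g subset_rfl (hf.joint hn).union_inputVars).computable (by simp) le_rfl

/-- Isoperimetry is applied to the values at one point of each of the `2 ^ k` subcubes: xoring with
a subcube indicator flips exactly one of these values. -/
theorem psi_growth_step {n k g : ℕ} (hn : 0 < n) (hk : k ≤ n)
    (h : psi n g ^ 2 ≤ 2 ^ 2 ^ k) : 3 * psi n g ≤ 2 * psi n (g + (k + 2)) := by
  let e : (Fin k → Bool) → Fin n → Bool := fun y i => if hi : i.1 < k then y ⟨i, hi⟩ else false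
  have hself : ∀ y, subcube hk y (e y) = true := by intro y; simp [subcube, e]
  have hne : ∀ y z, y ≠ z → subcube hk y (e z) = false := by
    intro y z hyz
    simp only [subcube, e, Fin.val_castLE, Fin.is_lt, dite_true, Fin.eta, decide_eq_false_iff_not]
    exact fun h' => hyz (funext h').symm
  obtain ⟨y, hy⟩ := exists_flip_growth (fun y f => f (e y))
    (fun y (f : BoolFn n) x => f x ^^ subcube hk y x)
    (fun y f f' hff => by
      funext x
      have := congrFun hff x
      simpa using this)
    (fun y f => by simp [hself]) (fun y z f hyz => by simp [hne y z hyz])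
    (sizeClass n g) (by simpa [card_sizeClass] using h)
  rw [card_sizeClass] at hy
  refine hy.trans (Nat.mul_le_mul_left 2 ?_)
  rw [← card_sizeClass]
  refine Finset.card_le_card (Finset.union_subset (sizeClass_mono (by omega)) ?_)
  intro f' hf'
  obtain ⟨f, hf, rfl⟩ := Finset.mem_image.mp hf'
  exact mem_sizeClass.mpr (computable_xor_subcube hn hk y (mem_sizeClass.mp hf))

theorem psi_mono {n g g' : ℕ} (h : g ≤ g') : psi n g ≤ psi n g' := by
  rw [← card_sizeClass, ← card_sizeClass]
  exact Finset.card_le_card (sizeClass_mono h)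

/-- If the target were missed, every intermediate count would stay small enough for the growth step
to apply, and `2 * (n + 1)` steps would give a factor (9/4)^(n+1), which exceeds 2^(n+1). -/
theorem psi_growth {n k g G : ℕ} (hn : 0 < n) (hk : k ≤ n)
    (hψ : (2 ^ (n + 1) * psi n g) ^ 2 ≤ 2 ^ 2 ^ k)
    (hG : g + 2 * (n + 1) * (k + 2) ≤ G) : 2 ^ (n + 1) * psi n g ≤ psi n G := by
  by_contra! hcon
  have H : ∀ i ≤ 2 * (n + 1), 3 ^ i * psi n g ≤ 2 ^ i * psi n (g + i * (k + 2)) := by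
    intro i hi
    induction i with
    | zero => simp
    | succ i ih =>
      have h1 := ih (by omega)
      have h2 : psi n (g + i * (k + 2)) ≤ 2 ^ (n + 1) * psi n g := by
        refine (psi_mono ?_).trans hcon.le
        have : i * (k + 2) ≤ 2 * (n + 1) * (k + 2) := Nat.mul_le_mul_right _ (by omega)
        omega
      have h3 := psi_growth_step hn hk ((Nat.pow_le_pow_left h2 2).trans hψ)
      have h4 : g + (i + 1) * (k + 2) = g + i * (k + 2) + (k + 2) := by ring
      rw [h4, pow_succ, pow_succ]
      nlinarith [Nat.two_pow_pos i]
  have h1 := H _ le_rfl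
  have h2 := (psi_mono (n := n) hG)
  have h3 : (2 : ℕ) ^ (n + 1) * 2 ^ (2 * (n + 1)) ≤ 3 ^ (2 * (n + 1)) := by
    rw [pow_mul, pow_mul, ← mul_pow]
    exact Nat.pow_le_pow_left (by norm_num) _
  have h4 := Nat.mul_le_mul_right (psi n g) h3
  have h5 := Nat.mul_lt_mul_of_pos_left (h2.trans_lt hcon) (Nat.two_pow_pos (2 * (n + 1)))
  have h6 : 2 ^ (n + 1) * 2 ^ (2 * (n + 1)) * psi n g =
    2 ^ (2 * (n + 1)) * (2 ^ (n + 1) * psi n g) := by ring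
  omega

/-! ### Hamming balls -/

theorem ncard_hammingBall_eq {n : ℕ} (h h' : BoolFn n) (r : ℕ) :
    (hammingBall h r).ncard = (hammingBall h' r).ncard := by
  have key : ∀ h h' : BoolFn n, (hammingBall h r).ncard ≤ (hammingBall h' r).ncard := by
    intro h h'
    -- Translation by `h` xor `h'` is an isometry.
    refine Set.ncard_le_ncard_of_injOn (fun f x => f x ^^ (h x ^^ h' x)) ?_ ?_ (Set.toFinite _)
    · intro f hf
      refine le_trans (le_of_eq ?_) (show hammingDist f h ≤ r from hf)
      unfold hammingDist
      congr 1
      ext x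
      simp only [Finset.mem_filter, Finset.mem_univ, true_and]
      cases f x <;> cases h x <;> cases h' x <;> simp
    · intro f _ f' _ hff
      funext x
      have := congrFun hff x
      simpa using this
  exact (key h h').antisymm (key h' h)

theorem ncard_hammingBall_succ_le {n : ℕ} (h : BoolFn n) (r : ℕ) :
    (hammingBall h (r + 1)).ncard ≤ (2 ^ n + 1) * (hammingBall h r).ncard := by
  classical
  let F : Option (Fin n → Bool) × BoolFn n → BoolFn n := fun p =>
    match p.1 with
    | none => p.2
    | some x => Function.update p.2 x (!p.2 x)
  -- Flipping one disagreement moves a point of the larger ball into the smaller one.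
  have hsub : hammingBall h (r + 1) ⊆ F '' (Set.univ ×ˢ hammingBall h r) := by
    intro f hf
    have hf : hammingDist f h ≤ r + 1 := hf
    by_cases hr : hammingDist f h ≤ r
    · exact ⟨(none, f), ⟨trivial, hr⟩, rfl⟩
    · have hpos : 0 < hammingDist f h := by omega
      obtain ⟨x, hx⟩ := Function.ne_iff.mp (hammingDist_pos.mp hpos)
      refine ⟨(some x, Function.update f x (!f x)), ⟨trivial, ?_⟩, ?_⟩
      · have hlt : hammingDist (Function.update f x (!f x)) h < hammingDist f h := by
          refine Finset.card_lt_card (Finset.ssubset_iff_of_subset ?_ |>.mpr ⟨x, ?_, ?_⟩)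
          · intro y
            simp only [Finset.mem_filter, Finset.mem_univ, true_and]
            by_cases hy : y = x
            · subst hy; exact fun _ => hx
            · rw [Function.update_of_ne hy]; exact id
          · simpa using hx
          · simp only [Finset.mem_filter, Finset.mem_univ, true_and, Function.update_self,
              not_not]
            revert hx
            cases f x <;> cases h x <;> simp
        exact Nat.le_of_lt_succ (hlt.trans_le hf)
      · simp [F]
  calc _ ≤ (F '' (Set.univ ×ˢ hammingBall h r)).ncard := Set.ncard_le_ncard hsub (Set.toFinite _)
    _ ≤ (Set.univ ×ˢ hammingBall h r : Set (Option (Fin n → Bool) × BoolFn n)).ncard :=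
      Set.ncard_image_le (Set.toFinite _)
    _ = _ := by rw [Set.ncard_prod, Set.ncard_univ]; simp

/-- If a family `A` of functions is nonempty and not everything, then some Hamming ball misses `A`
and is not much smaller than the volume bound allows. -/
theorem exists_large_hammingBall_disjoint {n : ℕ} (A : Finset (BoolFn n)) (hA : A.Nonempty)
    (hA' : A.card < 2 ^ 2 ^ n) :
    ∃ (h : BoolFn n) (r : ℕ), (∀ f ∈ hammingBall h r, f ∉ A) ∧
      2 ^ 2 ^ n ≤ A.card * ((2 ^ n + 1) * (hammingBall h r).ncard) := by
  classical
  have hcard : Fintype.card (BoolFn n) = 2 ^ 2 ^ n := by simp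
  let P : ℕ → Prop := fun r => ∃ h : BoolFn n, ∀ f ∈ hammingBall h r, f ∉ A
  have h0 : P 0 := by
    obtain ⟨h, hh⟩ : ∃ h, h ∉ A := by
      by_contra! hall
      rw [Finset.eq_univ_iff_forall.mpr hall, Finset.card_univ, hcard] at hA'
      exact lt_irrefl _ hA'
    refine ⟨h, fun f hf => ?_⟩
    have : hammingDist f h ≤ 0 := hf
    rw [hammingDist_eq_zero.mp (by omega : hammingDist f h = 0)]
    exact hh
  have hN : ¬ P (2 ^ n) := by
    rintro ⟨h, hh⟩
    obtain ⟨f, hf⟩ := hA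
    refine hh f (show hammingDist f h ≤ 2 ^ n from ?_) hf
    have := hammingDist_le_card_fintype (x := f) (y := h)
    simpa using this
  obtain ⟨r, hr, hr'⟩ : ∃ r, P r ∧ ¬ P (r + 1) := by
    by_contra! hcon
    exact hN (Nat.rec h0 (fun r hr => hcon r hr) (2 ^ n))
  obtain ⟨h, hh⟩ := hr
  refine ⟨h, r, hh, ?_⟩
  -- Every ball of radius `r + 1` meets `A`; by symmetry of the distance, the balls of that radius
  -- around `A` cover everything.
  have hcov : (Finset.univ : Finset (BoolFn n)) ⊆
      A.biUnion fun f => (Set.toFinite (hammingBall f (r + 1))).toFinset := by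
    intro f' _
    by_contra hnot
    refine hr' ⟨f', fun f hf hfA => hnot ?_⟩
    simp only [Finset.mem_biUnion, Set.Finite.mem_toFinset]
    refine ⟨f, hfA, ?_⟩
    have : hammingDist f f' ≤ r + 1 := hf
    rwa [hammingDist_comm] at this
  have h1 := (Finset.card_le_card hcov).trans
    (Finset.card_biUnion_le_card_mul A _ ((hammingBall h (r + 1)).ncard) fun f _ => by
      rw [← Set.ncard_eq_toFinset_card]
      exact (ncard_hammingBall_eq f h (r + 1)).le)
  rw [Finset.card_univ, hcard] at h1
  exact h1.trans (Nat.mul_le_mul_left _ (ncard_hammingBall_succ_le h r))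

/-! ### Choice of parameters and numerical estimates -/

theorem psi_half_bounds {n c : ℕ} (hn : 0 < n)
    (hlow : 8 * (n + 1) * (Nat.clog 2 c + 1) ≤ c) (hup : 4 * c * n ≤ 2 ^ n) :
    2 ^ (n + 1) * psi n (c / 2) ≤ psi n c ∧ psi n (c / 2) < 2 ^ 2 ^ n := by
  set l := Nat.clog 2 c with hl
  set g := c / 2 with hg
  have hcl : c ≤ 2 ^ l := Nat.le_pow_clog one_lt_two c
  have hnc : 8 * (n + 1) ≤ c := le_trans (Nat.le_mul_of_pos_right _ (by omega)) hlow
  have hl2 : l + 2 ≤ n := by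
    have h1 : 4 * c ≤ 2 ^ n := le_trans (Nat.le_mul_of_pos_right _ hn) hup
    have hn2 : 2 ≤ n := by
      by_contra! h
      have := Nat.pow_le_pow_right (n := 2) two_pos (show n ≤ 1 by omega)
      omega
    have h2 : c ≤ 2 ^ (n - 2) := by
      obtain ⟨m, rfl⟩ := Nat.exists_eq_add_of_le hn2
      rw [pow_add] at h1
      simp only [add_tsub_cancel_left]
      omega
    have := Nat.clog_le_of_le_pow h2
    omega
  have hψ : psi n g ≤ 2 ^ ((4 + 2 * l) * g + l) := by
    refine (psi_le n g (2 ^ l) hn (by omega)).trans (le_of_eq ?_)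
    rw [pow_add, pow_mul, pow_add, pow_mul']
    norm_num
  -- At most `n` variables can be fixed. The cap `2 * l` keeps the total cost of the rounds within
  -- `c / 2`, while `2 ^ (2 * l) ≥ c ^ 2` still dominates the exponent, which is of order c log c.
  set k := min n (2 * l) with hk
  have hkn : k ≤ n := min_le_left _ _
  have hexp : 2 * (n + 1 + ((4 + 2 * l) * g + l)) ≤ 2 ^ k := by
    have hE : (4 + 2 * l) * g ≤ (2 + l) * c := by
      have : (4 + 2 * l) * g = (2 + l) * (2 * g) := by ring
      rw [this]
      exact Nat.mul_le_mul_left _ (by omega)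
    rcases le_total n (2 * l) with h | h
    · rw [hk, min_eq_left h]
      have h1 : (2 + l) * c ≤ n * c := Nat.mul_le_mul_right _ (by omega)
      have h2 : 8 * n ≤ c * n := Nat.mul_le_mul_right _ (by omega)
      have h3 : 4 * c * n = 4 * (c * n) := by ring
      rw [mul_comm n c] at h1
      omega
    · rw [hk, min_eq_right h, mul_comm 2 l, pow_mul]
      have h1 := Nat.pow_le_pow_left hcl 2
      have h2 := Nat.mul_le_mul_right c hlow
      have h3 : 4 * (l + 1) * c ≤ 4 * (n + 1) * (l + 1) * c := by
        gcongr
        omega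
      have h4 : n + 1 + l ≤ (n + 1) * (l + 1) * c := by
        calc n + 1 + l ≤ (n + 1) * (l + 1) * 1 := by nlinarith
          _ ≤ _ := by gcongr; omega
      nlinarith
  have hsq : (2 ^ (n + 1) * psi n g) ^ 2 ≤ 2 ^ 2 ^ k := by
    calc (2 ^ (n + 1) * psi n g) ^ 2 ≤ (2 ^ (n + 1) * 2 ^ ((4 + 2 * l) * g + l)) ^ 2 := by gcongr
      _ = 2 ^ (2 * (n + 1 + ((4 + 2 * l) * g + l))) := by rw [← pow_add, ← pow_mul, mul_comm]
      _ ≤ _ := Nat.pow_le_pow_right two_pos hexp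
  refine ⟨psi_growth hn hkn hsq ?_, ?_⟩
  · have h1 : k + 2 ≤ 2 * (l + 1) := by omega
    have h2 := Nat.mul_le_mul_left (2 * (n + 1)) h1
    have h3 : 8 * (n + 1) * (l + 1) = 2 * (2 * (n + 1) * (2 * (l + 1))) := by ring
    omega
  · have hpos := psi_pos hn g
    calc psi n g < 2 ^ (n + 1) * psi n g := by
          have := Nat.one_lt_two_pow (n := n + 1) (by omega)
          nlinarith
      _ ≤ (2 ^ (n + 1) * psi n g) ^ 2 := Nat.le_self_pow two_ne_zero _
      _ ≤ 2 ^ 2 ^ k := hsq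
      _ ≤ 2 ^ 2 ^ n := Nat.pow_le_pow_right two_pos (Nat.pow_le_pow_right two_pos hkn)

theorem mul_sq_le_two_pow (l : ℕ) (hl : 25 ≤ l) : 512 * (l + 1) ^ 2 ≤ 2 ^ l := by
  induction l, hl using Nat.le_induction with
  | base => norm_num
  | succ l hl ih =>
    rw [pow_succ 2 l]
    nlinarith

theorem mul_clog_le_of_large {n c : ℕ} (hn : 2 ^ 13 ≤ n)
    (h : 96 * (n * Real.logb 2 n) ≤ c) : 8 * (n + 1) * (Nat.clog 2 c + 1) ≤ c := by
  set l := Nat.clog 2 c with hl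
  have hn' : (2 : ℝ) ^ 13 ≤ n := by exact_mod_cast hn
  have hlog : 13 ≤ Real.logb 2 n := by
    rw [Real.le_logb_iff_rpow_le one_lt_two (by linarith)]
    exact_mod_cast hn'
  have hc : 1 < c := by
    have : (1 : ℝ) < c := by nlinarith
    exact_mod_cast this
  have hlt : 2 ^ (l - 1) < c := Nat.pow_pred_clog_lt_self one_lt_two hc
  have hlpos : 0 < l := Nat.clog_pos one_lt_two hc
  have h2l : 2 ^ l < 2 * c := by
    obtain ⟨m, hm⟩ : ∃ m, l = m + 1 := ⟨l - 1, by omega⟩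
    rw [hm] at hlt ⊢
    rw [pow_succ]
    simp only [add_tsub_cancel_right] at hlt
    omega
  -- For `c ≥ n ^ 2`, `n` is at most the square root of `c` and the logarithmic factor is
  -- negligible; otherwise log c = O(log n) and the hypothesis suffices.
  rcases le_total (n ^ 2) c with hnc | hnc
  · have hl25 : 25 ≤ l := by
      have h1 : (2 ^ 13) ^ 2 ≤ c := (Nat.pow_le_pow_left hn 2).trans hnc
      have h2 : c ≤ 2 ^ l := Nat.le_pow_clog one_lt_two c
      by_contra! hcon
      have := Nat.pow_le_pow_right (n := 2) two_pos (show l ≤ 24 by omega)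
      omega
    have h1 := mul_sq_le_two_pow l hl25
    have h2 : (8 * (n + 1) * (l + 1)) ^ 2 ≤ c ^ 2 := by
      calc (8 * (n + 1) * (l + 1)) ^ 2 ≤ (8 * (n + n) * (l + 1)) ^ 2 := by gcongr; omega
        _ = n ^ 2 * (256 * (l + 1) ^ 2) := by ring
        _ ≤ c * c := Nat.mul_le_mul hnc (by omega)
        _ = c ^ 2 := (sq c).symm
    exact (Nat.pow_le_pow_iff_left two_ne_zero).mp h2
  · have hlr : (l : ℝ) ≤ 2 * Real.logb 2 n + 1 := by
      have h1 : (2 : ℝ) ^ l ≤ 2 * (n : ℝ) ^ 2 := by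
        have : 2 ^ l ≤ 2 * n ^ 2 := by omega
        exact_mod_cast this
      have h2 := Real.logb_le_logb_of_le one_lt_two (by positivity) h1
      rw [Real.logb_mul two_ne_zero (by positivity), Real.logb_pow, Real.logb_pow,
        Real.logb_self_eq_one one_lt_two] at h2
      push_cast at h2
      linarith
    have h3 : (8 * ((n : ℝ) + 1) * (l + 1)) ≤ c := by
      calc (8 * ((n : ℝ) + 1) * (l + 1)) ≤ 8 * (2 * n) * (3 * Real.logb 2 n) := by
            gcongr <;> linarith
        _ ≤ 96 * (n * Real.logb 2 n) := by nlinarith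
        _ ≤ c := h
    exact_mod_cast h3

theorem eventually_mul_logb_le {gam lam : ℕ → ℕ}
    (hlam : (fun n : ℕ => (n : ℝ) * Real.logb 2 n) =O[atTop] (fun n : ℕ => (lam n : ℝ)))
    (hout : Outstrips gam lam) {B : ℝ} (hB : 0 < B) :
    ∀ᶠ n : ℕ in atTop, B * ((n : ℝ) * Real.logb 2 n) ≤ gam n := by
  obtain ⟨K, hK, hKb⟩ := hlam.exists_pos
  obtain ⟨n₀, hn₀⟩ := hout (B * K) (by positivity)
  filter_upwards [hKb.bound, eventually_ge_atTop n₀] with n h1 h2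
  rw [Real.norm_eq_abs, Real.norm_eq_abs, Nat.abs_cast] at h1
  have h3 := mul_le_mul_of_nonneg_left ((le_abs_self _).trans h1) hB.le
  have h4 := hn₀ n h2
  linarith

theorem four_mul_le_two_pow {n c : ℕ} (hn : 0 < n)
    (h : (c : ℝ) ≤ (2 : ℝ) ^ ((n : ℝ) - 2) / n) : 4 * c * n ≤ 2 ^ n := by
  have hn' : (0 : ℝ) < n := by exact_mod_cast hn
  rw [le_div_iff₀ hn', Real.rpow_sub two_pos, Real.rpow_natCast] at h
  norm_num at h
  have : 4 * (c : ℝ) * n ≤ 2 ^ n := by linarith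
  exact_mod_cast this

theorem computable_half_iff {n c : ℕ} (f : BoolFn n) :
    ComputableWithGates f ((c : ℝ) / 2) ↔ f ∈ sizeClass n (c / 2) := by
  rw [mem_sizeClass]
  constructor
  · rintro ⟨g, C, hg, hC⟩
    refine ⟨g, C, ?_, hC⟩
    have h1 : (g : ℝ) * 2 ≤ c := by linarith
    have h2 : g * 2 ≤ c := by exact_mod_cast h1
    exact_mod_cast (Nat.le_div_iff_mul_le two_pos).mpr h2
  · exact fun h => h.mono Nat.cast_div_le

theorem exists_hard_hammingBall {n c : ℕ} (hn : 0 < n)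
    (hlow : 8 * (n + 1) * (Nat.clog 2 c + 1) ≤ c) (hup : 4 * c * n ≤ 2 ^ n) :
    ∃ (h : BoolFn n) (r : ℕ),
      (∀ f ∈ hammingBall h r, ¬ ComputableWithGates f ((c : ℝ) / 2)) ∧
      (2 : ℝ) ^ (2 ^ n) * (1 / (psi n c : ℝ)) ≤ (hammingBall h r).ncard := by
  obtain ⟨hgrow, hlt⟩ := psi_half_bounds hn hlow hup
  have hpos := psi_pos hn (c / 2)
  obtain ⟨h, r, hdisj, hbig⟩ := exists_large_hammingBall_disjoint (sizeClass n (c / 2))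
    (by rw [← Finset.card_pos, card_sizeClass]; exact hpos) (by rwa [card_sizeClass])
  refine ⟨h, r, fun f hf hc => hdisj f hf ((computable_half_iff f).mp hc), ?_⟩
  have hpos' : (0 : ℝ) < psi n c := by exact_mod_cast psi_pos hn c
  rw [mul_one_div, div_le_iff₀ hpos']
  rw [card_sizeClass, ← mul_assoc] at hbig
  -- The volume loss `2 ^ n + 1` is at most the growth factor `2 ^ (n + 1)`.
  have h1 : psi n (c / 2) * (2 ^ n + 1) ≤ psi n c := by
    refine le_trans ?_ hgrow
    rw [mul_comm, pow_succ]
    have := Nat.two_pow_pos n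
    exact Nat.mul_le_mul_right _ (by omega)
  have h2 : 2 ^ 2 ^ n ≤ (hammingBall h r).ncard * psi n c := by
    rw [mul_comm]
    exact hbig.trans (Nat.mul_le_mul_right _ h1)
  exact_mod_cast h2

end AlmostNatural

/-! ### Assembling the property -/

theorem theorem4p3 (gam lam : ℕ → ℕ)
    (hlam : (fun n : ℕ => (n : ℝ) * Real.logb 2 n) =O[Filter.atTop] (fun n : ℕ => (lam n : ℝ)))
    (hout : AlmostNatural.Outstrips gam lam)
    (hgam : ∀ᶠ n : ℕ in Filter.atTop, (gam n : ℝ) ≤ (2 : ℝ) ^ ((n : ℝ) - 2) / n) :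
    ∃ C : AlmostNatural.BoolProperty,
      AlmostNatural.NonuniformlyLinearNatural C
        (fun n => 1 / (AlmostNatural.psi n (gam n) : ℝ)) ∧
      AlmostNatural.UsefulAgainst C (AlmostNatural.SIZE lam) ∧
      (∀ n : ℕ, ∃ (h : AlmostNatural.BoolFn n) (r : ℕ), C n = AlmostNatural.hammingBall h r) ∧
      (∀ᶠ n : ℕ in Filter.atTop, ∀ f ∈ C n,
        ¬ AlmostNatural.ComputableWithGates f ((gam n : ℝ) / 2)) := by
  have hball : ∀ n : ℕ, ∃ (h : AlmostNatural.BoolFn n) (r : ℕ),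
      0 < n → 8 * (n + 1) * (Nat.clog 2 (gam n) + 1) ≤ gam n → 4 * gam n * n ≤ 2 ^ n →
      (∀ f ∈ AlmostNatural.hammingBall h r,
        ¬ AlmostNatural.ComputableWithGates f ((gam n : ℝ) / 2)) ∧
      (2 : ℝ) ^ (2 ^ n) * (1 / (AlmostNatural.psi n (gam n) : ℝ)) ≤
        (AlmostNatural.hammingBall h r).ncard := by
    intro n
    by_cases hgood : 0 < n ∧ 8 * (n + 1) * (Nat.clog 2 (gam n) + 1) ≤ gam n ∧
        4 * gam n * n ≤ 2 ^ n
    · obtain ⟨h, r, hr⟩ := AlmostNatural.exists_hard_hammingBall hgood.1 hgood.2.1 hgood.2.2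
      exact ⟨h, r, fun _ _ _ => hr⟩
    -- For the remaining `n` any ball will do: the circuit bound holds for every ball, and the other
    -- claims are asymptotic.
    · exact ⟨fun _ => false, 0, fun h1 h2 h3 => absurd ⟨h1, h2, h3⟩ hgood⟩
  choose h r hr using hball
  have hev : ∀ᶠ n : ℕ in Filter.atTop,
      (∀ f ∈ AlmostNatural.hammingBall (h n) (r n),
        ¬ AlmostNatural.ComputableWithGates f ((gam n : ℝ) / 2)) ∧
      (2 : ℝ) ^ (2 ^ n) * (1 / (AlmostNatural.psi n (gam n) : ℝ)) ≤
        (AlmostNatural.hammingBall (h n) (r n)).ncard := by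
    filter_upwards [hgam, Filter.eventually_ge_atTop (2 ^ 13),
      AlmostNatural.eventually_mul_logb_le hlam hout (B := 96) (by norm_num)] with n h1 h2 h3
    have hn : 0 < n := by omega
    exact hr n hn (AlmostNatural.mul_clog_le_of_large h2 h3)
      (AlmostNatural.four_mul_le_two_pow hn h1)
  refine ⟨fun n => AlmostNatural.hammingBall (h n) (r n), ⟨?_, 12, fun n => ?_⟩, ?_,
    fun n => ⟨h n, r n, rfl⟩, hev.mono fun n hn => hn.1⟩
  · exact hev.mono fun n hn => hn.2
  · exact AlmostNatural.exists_circuit_hammingBall (h n) (r n)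
  · rintro f hf ⟨c, hc⟩
    -- The factor 2 brings `c * lam n` below `gam n / 2`; the maximum with 1 ensures a positive
    -- constant.
    obtain ⟨n₀, hn₀⟩ := hout (2 * max c 1) (by positivity)
    obtain ⟨n, hfn, hn, hcn, hnn⟩ :=
      (hf.and_eventually (hev.and (hc.and (Filter.eventually_ge_atTop n₀)))).exists
    refine hn.1 (f n) hfn (hcn.mono ?_)
    have h1 := hn₀ n hnn
    have h2 : c * (lam n : ℝ) ≤ max c 1 * lam n :=
      mul_le_mul_of_nonneg_right (le_max_left _ _) (Nat.cast_nonneg _)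
    linarith
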